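/- **Setting.** A bandit instance consists of $n\ge 1$ arms arriving in a stream; every pull of arm $i$ gives an independent reward from a distribution on $[0,1]$ with mean $p_i$. Arm $i$ is *$\varepsilon$-best* if $p_i\ge \max_j p_j-\varepsilon$. An algorithm is *$(\varepsilon,\delta)$-PAC* if on every instance it outputs an $\varepsilon$-best arm with probability at least $1-\delta$. **The algorithm (Assadi et al. 2020).** Let $r_1=4$, $r_{\ell+1}=2^{r_\ell}$, $\varepsilon_\ell=\varepsilon/(10\cdot 2^{\ell-1})$, $\beta_\ell=1/\varepsilon_\ell^2$, $s_\ell=\lceil 4\beta_\ell(\ln(1/\delta)+3r_\ell)\rceil$, $c_\ell=2^{r_\ell}/2^{\ell-1}$ (so $c_1=2^4$, $c_2=2^{15}$), and use levels $1,\dots,t$ with $t=\log^* n+1$. Here $\log^* n$ is the least $k$ with $\mathrm{ilog}^{(k)}(n)=1$, where $\mathrm{ilog}^{(0)}(n)=n$ and $\mathrm{ilog}^{(k+1)}(n)=\max\{\log_2\mathrm{ilog}^{(k)}(n),1\}$. Each level $\ell$ has a counter $C_\ell$, initially $0$, and room for one stored arm $\mathrm{arm}^*_\ell$, initially none. Each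 arriving arm enters level $1$. When an arm enters level $\ell$, it and $\mathrm{arm}^*_\ell$ are both freshly sampled $s_\ell$ times; the new arm is dropped if its empirical mean is smaller than that of $\mathrm{arm}^*_\ell$, and otherwise replaces $\mathrm{arm}^*_\ell$ (if no arm is stored at level $\ell$, the new arm is stored). Then $C_\ell$ is increased by one, and if $C_\ell=c_\ell$, then $C_\ell$ is reset to $0$ and $\mathrm{arm}^*_\ell$ leaves level $\ell$ and enters level $\ell+1$ (the last level $t$ keeps its arm). At the end of the stream the arm stored at the highest nonempty level is returned. **The streams.** For $0<\varepsilon<1/5$ and $n>c_1c_2$, let $\mathcal I_{n,\varepsilon}$ be the stream of $n$ arms with Bernoulli rewards of means $$p_i=\tfrac12-\Big\lceil \tfrac{i}{c_1}-1\Big\rceil\cdot\frac{\varepsilon}{c_2-2}\quad (1\le i\le c_1c_2),\qquad p_i=0\quad (i>c_1c_2).$$ **Theorem.** There is $\delta_0\in(0,1/2)$ such that for every $\delta\in(0,\delta_0]$ and every $\varepsilon$ with $0<\varepsilon<\min\{1/5,\ \delta\sqrt{\ln(1/\delta)}/c_2\}$ the following hold. 1. For every $n>c_1c_2$, on the stream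 $\mathcal I_{n,\varepsilon}$ the algorithm with parameters $\varepsilon,\delta$ outputs an arm that is not $\varepsilon$-best with probability greater than $\delta$. Moreover, with probability greater than $\delta$, no arm stored in its memory at the end of the stream is $\varepsilon$-best (so the same holds whichever stored arm is returned). 2. Consequently, the algorithm with parameters $\varepsilon,\delta$ is not $(\varepsilon,\delta)$-PAC. -/

import Mathlib

open MeasureTheory ProbabilityTheory

noncomputable section

namespace StreamingBandit

/-! ### Bandit instances -/

/-- An instance with `n` arms: arm `i` is the `i`-th arm of the stream (counted from `0`), and its
reward distribution `law i` is a probability measure supported on `[0, 1]`. -/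
structure BanditInstance (n : ℕ) where
  law : Fin n → Measure ℝ
  isProb : ∀ i, IsProbabilityMeasure (law i)
  support : ∀ i, ∀ᵐ x ∂(law i), x ∈ Set.Icc (0 : ℝ) 1

/-- The mean reward of arm `i`. -/
def BanditInstance.mean {n : ℕ} (I : BanditInstance n) (i : Fin n) : ℝ :=
  ∫ x, x ∂(I.law i)

/-- Arm `i` is an `ε`-best arm: its mean is at least `μ* - ε`, with `μ*` the largest mean. -/
def BanditInstance.IsEpsBest {n : ℕ} (I : BanditInstance n) (ε : ℝ) (i : Fin n) : Prop :=
  (⨆ j, I.mean j) - ε ≤ I.mean i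

/-- A single pull: the `idx`-th pull of `arm` in the challenge that takes place at level `level`
while the arm that arrived at time `time` is being processed. During the processing of one arrival
there is at most one challenge at each level, so different pulls have different labels. -/
structure Pull (n : ℕ) where
  arm : Fin n
  time : Fin n
  level : ℕ
  idx : ℕ

/-- A table of rewards, one for each potential pull. -/
abbrev RewardTable (n : ℕ) : Type := Pull n → ℝ

/-- The law of the reward table: all pulls are independent, and a pull of arm `i` has the reward
distribution of arm `i`. -/
def BanditInstance.tableLaw {n : ℕ} (I : BanditInstance n) : Measure (RewardTable n) :=
  Measure.infinitePi (fun q : Pull n => I.law q.arm)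

/-- `alg n ω` is the arm that an algorithm returns on a stream of `n` arms when the rewards are
given by `ω`. The algorithm is `(ε, δ)`-PAC if on every instance with at least one arm it returns an
`ε`-best arm with probability at least `1 - δ`. -/
def IsPAC (ε δ : ℝ) (alg : (n : ℕ) → RewardTable n → Option (Fin n)) : Prop :=
  ∀ (n : ℕ), 0 < n → ∀ I : BanditInstance n,
    1 - δ ≤ I.tableLaw.real {ω | ∃ a, alg n ω = some a ∧ I.IsEpsBest ε a}

/-! ### Parameters of the algorithm -/

/-- `r_1 = 4`, `r_{ℓ+1} = 2 ^ r_ℓ`. Levels start at `1`; the value at `0` is not used. -/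
def rLevel : ℕ → ℕ
  | 0 => 0
  | 1 => 4
  | (l + 2) => 2 ^ rLevel (l + 1)

/-- `ε_ℓ = ε / (10 * 2 ^ (ℓ - 1))`. -/
def epsLevel (ε : ℝ) (l : ℕ) : ℝ := ε / (10 * 2 ^ (l - 1))

/-- `β_ℓ = 1 / ε_ℓ ^ 2`. -/
def betaLevel (ε : ℝ) (l : ℕ) : ℝ := 1 / (epsLevel ε l) ^ 2

/-- `s_ℓ = 4 β_ℓ (ln (1 / δ) + 3 r_ℓ)`, rounded up to an integer: the number of samples per arm in
a challenge at level `ℓ`. -/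
def sLevel (ε δ : ℝ) (l : ℕ) : ℕ := ⌈4 * betaLevel ε l * (Real.log (1 / δ) + 3 * (rLevel l : ℝ))⌉₊

/-- `c_ℓ = 2 ^ r_ℓ / 2 ^ (ℓ - 1)` (so `c_1 = 2 ^ r_1`; for `ℓ ≥ 1` the division is exact): the number
of arms processed at level `ℓ` before the stored arm is sent to level `ℓ + 1`. -/
def cLevel (l : ℕ) : ℕ := 2 ^ rLevel l / 2 ^ (l - 1)

/-- The iterated binary logarithm: `ilog 0 a = a`, `ilog (k + 1) a = max (log₂ (ilog k a)) 1`. -/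
def ilog : ℕ → ℝ → ℝ
  | 0, a => a
  | (k + 1), a => max (Real.logb 2 (ilog k a)) 1

/-- `log* n`: the least `k` such that `ilog k n = 1`. -/
def logStar (n : ℕ) : ℕ := sInf {k : ℕ | ilog k (n : ℝ) = 1}

/-- The number `t = log* n + 1` of levels. -/
def numLevels (n : ℕ) : ℕ := logStar n + 1

/-! ### The algorithm -/

/-- The memory of the algorithm: the counters `C_ℓ`, and the stored arms `arm*_ℓ` (`none` if no arm
is stored at level `ℓ`). -/
structure Memory (n : ℕ) where
  count : ℕ → ℕ
  stored : ℕ → Option (Fin n)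

/-- The empirical mean of arm `a` over its `m` samples in the challenge at level `l` while the arm
that arrived at time `j` is processed. -/
def empMean {n : ℕ} (ω : RewardTable n) (m : ℕ) (j : Fin n) (l : ℕ) (a : Fin n) : ℝ :=
  (∑ k ∈ Finset.range m, ω ⟨a, j, l, k⟩) / m

open Classical in
/-- The challenge at level `l`: both the challenger `a` and the arm stored at level `l` are sampled
afresh `s_l` times. The challenger is dropped if its empirical mean is smaller than that of the
stored arm, and otherwise takes its place. If no arm is stored at level `l`, the challenger is
stored. The value is the arm stored at level `l` after the challenge. -/
def challenge {n : ℕ} (ε δ : ℝ) (ω : RewardTable n) (j : Fin n) (l : ℕ) (M : Memory n)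
    (a : Fin n) : Fin n :=
  match M.stored l with
  | none => a
  | some b =>
    if empMean ω (sLevel ε δ l) j l a < empMean ω (sLevel ε δ l) j l b then b else a

/-- Store arm `w` at level `l` and increase the counter of level `l` by one. -/
def Memory.keep {n : ℕ} (M : Memory n) (l : ℕ) (w : Fin n) : Memory n where
  count := Function.update M.count l (M.count l + 1)
  stored := Function.update M.stored l (some w)

/-- Empty level `l` and set its counter to zero. -/
def Memory.clear {n : ℕ} (M : Memory n) (l : ℕ) : Memory n where
  count := Function.update M.count l 0
  stored := Function.update M.stored l none

/-- Selective promotion of arm `a`, from level `l` on, where `d` is the number of levels above `l`.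
After the challenge at level `l` the counter `C_l` is increased by one. When it reaches `c_l`, it is
set to zero and the stored arm leaves level `l` and is sent to level `l + 1`. The top level
(`d = 0`) has no level above it and keeps its arm. -/
def promote {n : ℕ} (ε δ : ℝ) (ω : RewardTable n) (j : Fin n) :
    (d : ℕ) → (l : ℕ) → Fin n → Memory n → Memory n
  | 0, l, a, M => M.keep l (challenge ε δ ω j l M a)
  | (d + 1), l, a, M =>
    if M.count l + 1 = cLevel l then
      promote ε δ ω j d (l + 1) (challenge ε δ ω j l M a) (M.clear l)
    else
      M.keep l (challenge ε δ ω j l M a)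

/-- The memory before the first arrival. -/
def Memory.init (n : ℕ) : Memory n where
  count := fun _ => 0
  stored := fun _ => none

/-- The memory after the whole stream has been processed. Each arriving arm enters at level `1`, and
the levels are `1, …, t`. -/
def finalMemory (ε δ : ℝ) (n : ℕ) (ω : RewardTable n) : Memory n :=
  (List.finRange n).foldl (fun M j => promote ε δ ω j (numLevels n - 1) 1 j M) (Memory.init n)

/-- The arm stored at the highest nonempty level among `1, …, t`. -/
def Memory.topArm {n : ℕ} (M : Memory n) : (t : ℕ) → Option (Fin n)
  | 0 => none
  | (t + 1) =>
    match M.stored (t + 1) with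
    | some a => some a
    | none => Memory.topArm M t

/-- The arm returned by the algorithm. -/
def assadiOutput (ε δ : ℝ) (n : ℕ) (ω : RewardTable n) : Option (Fin n) :=
  (finalMemory ε δ n ω).topArm (numLevels n)

/-! ### The adversarial streams -/

/-- The mean of arm `i` (counted from `0`): the first `c_1 * c_2` arms form `c_2` consecutive blocks
of `c_1` arms, all arms of block `m = 0, …, c_2 - 1` have mean `1 / 2 - m * ε / (c_2 - 2)`, and all
later arms have mean `0`. -/
def advMean (ε : ℝ) (i : ℕ) : ℝ :=
  if i < cLevel 1 * cLevel 2 then 1 / 2 - ((i / cLevel 1 : ℕ) : ℝ) * (ε / ((cLevel 2 : ℝ) - 2)) else 0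

theorem cLevel_one : cLevel 1 = 16 := by norm_num [cLevel, rLevel]

theorem cLevel_two : cLevel 2 = 32768 := by norm_num [cLevel, rLevel]

theorem advMean_mem {ε : ℝ} (h0 : 0 < ε) (h1 : ε < 1 / 5) (i : ℕ) :
    advMean ε i ∈ Set.Icc (0 : ℝ) 1 := by
  unfold advMean
  rw [cLevel_one, cLevel_two]
  split_ifs with h
  · have h2 : i / 16 ≤ 32767 := by omega
    have h3 : ((i / 16 : ℕ) : ℝ) ≤ 32767 := by exact_mod_cast h2
    have h4 : (0 : ℝ) ≤ ((i / 16 : ℕ) : ℝ) := Nat.cast_nonneg _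
    push_cast
    constructor
    · have : ((i / 16 : ℕ) : ℝ) * (ε / (32768 - 2)) ≤ 32767 * (ε / (32768 - 2)) := by
        apply mul_le_mul_of_nonneg_right h3
        apply div_nonneg h0.le
        norm_num
      linarith
    · have : 0 ≤ ((i / 16 : ℕ) : ℝ) * (ε / (32768 - 2)) := by
        apply mul_nonneg h4
        apply div_nonneg h0.le
        norm_num
      linarith
  · simp

/-- The adversarial stream of `n` arms: rewards are Bernoulli with the means `advMean ε i`. -/
def advInstance (n : ℕ) (ε : ℝ) (h0 : 0 < ε) (h1 : ε < 1 / 5) : BanditInstance n where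
  law := fun i => bernoulliMeasure (1 : ℝ) 0 ⟨advMean ε i, advMean_mem h0 h1 i⟩
  isProb := fun _ => inferInstance
  support := fun i => by
    rw [ae_iff, bernoulliMeasure_def]
    simp

end StreamingBandit

end

open StreamingBandit

open StreamingBandit

/-! Every block of 16 arms of equal mean sends exactly one arm to level 2, so level 2 meets 32768
challengers whose means drop by `ε / 32766` each time. The total drop `32767 / 32766 * ε` exceeds
`ε`. If each challenger from the second on replaces its predecessor, an arm of the last block moves
on to level 3, levels 1 and 2 are left empty, and only arms of mean 0 can follow; then no arm in
memory is `ε`-best.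

Write `L = ln (1 / δ)`. A level-2 challenge takes about `1600 (L + 48) / ε ^ 2` samples per arm,
which cannot resolve a gap of `ε / 32766`: the exponent of the `χ²` factor is only about `8000 L /
32766 ^ 2`. At equal means the challenger wins with probability at least `1 / 2`, by symmetry and
because ties favour it. Cauchy–Schwarz transfers this to unequal means (`quarter_le_sum_winning`),
so one win has probability at least `exp (-2 - 8004 L / 32766 ^ 2)` (`exp_le_duel`).

Samples are fresh, so these bounds multiply along the chain (`mul_secondWinner_le`). All 32767 wins
together have probability at least about `exp (-65534 - 0.245 L)`, which exceeds `δ = exp (-L)` as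
soon as `L ≥ 100000` (`lt_secondWinner`). -/

namespace StreamingBandit

/-! ### Comparing two series of coin tosses -/

/-- The probability that a coin with success probability `r` shows `b`. -/
def coinWeight (r : ℝ) (b : Bool) : ℝ := if b then r else 1 - r

theorem coinWeight_nonneg {r : ℝ} (h0 : 0 ≤ r) (h1 : r ≤ 1) (b : Bool) : 0 ≤ coinWeight r b := by
  cases b <;> simp [coinWeight, h0, h1]

theorem coinWeight_pos {r : ℝ} (h0 : 0 < r) (h1 : r < 1) (b : Bool) : 0 < coinWeight r b := by
  cases b <;> simp [coinWeight, h0, h1]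

/-- The outcomes of two series of `s` coin tosses in which the first series (label `true`) has at
least as many successes as the second one (label `false`). -/
noncomputable def winning (s : ℕ) : Finset (Bool × Fin s → Bool) :=
  Finset.univ.filter fun x =>
    ∑ k, (if x (false, k) then (1 : ℝ) else 0) ≤ ∑ k, (if x (true, k) then (1 : ℝ) else 0)

/-- Exchanging the two series preserves the weight when both have parameter `p`, and it maps every
losing outcome to a winning one. Hence winning is at least as likely as losing. -/
theorem half_le_sum_winning (s : ℕ) {p : ℝ} (h0 : 0 ≤ p) (h1 : p ≤ 1) :
    1 / 2 ≤ ∑ x ∈ winning s, ∏ i, coinWeight p (x i) := by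
  have htot : ∑ x : Bool × Fin s → Bool, ∏ i, coinWeight p (x i) = 1 := by
    rw [← Fintype.prod_sum]
    simp [coinWeight]
  let σ : (Bool × Fin s → Bool) → (Bool × Fin s → Bool) := fun x i => x (!i.1, i.2)
  have hσ : ∀ x, ∏ i, coinWeight p (σ x i) = ∏ i, coinWeight p (x i) := by
    intro x
    simp only [σ, Fintype.prod_prod_type, Fintype.prod_bool]
    simp [mul_comm]
  have hinv : ∀ x, σ (σ x) = x := by
    intro x
    funext i
    simp [σ]
  have hle : ∑ x ∈ (winning s)ᶜ, ∏ i, coinWeight p (x i) ≤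
      ∑ x ∈ winning s, ∏ i, coinWeight p (x i) := by
    calc ∑ x ∈ (winning s)ᶜ, ∏ i, coinWeight p (x i)
        = ∑ x ∈ (winning s)ᶜ.image σ, ∏ i, coinWeight p (x i) := by
          rw [Finset.sum_image]
          · simp only [hσ]
          · intro x _ y _ h
            rw [← hinv x, ← hinv y, h]
      _ ≤ _ := by
          apply Finset.sum_le_sum_of_subset_of_nonneg
          · intro y hy
            obtain ⟨x, hx, rfl⟩ := Finset.mem_image.1 hy
            simp only [winning, Finset.mem_compl, Finset.mem_filter, Finset.mem_univ, true_and,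
              not_le] at hx
            simpa [winning, σ] using hx.le
          · intro x _ _
            exact Finset.prod_nonneg fun i _ => coinWeight_nonneg h0 h1 _
  have := Finset.sum_add_sum_compl (winning s) fun x => ∏ i, coinWeight p (x i)
  linarith

/-- Lowering the success probability of the first series from `p` to `q` costs at most a factor
given by the `χ²`-divergence of the two series. -/
theorem quarter_le_sum_winning (s : ℕ) {p q : ℝ} (h0 : 0 ≤ p) (h1 : p ≤ 1) (hq0 : 0 < q)
    (hq1 : q < 1) :
    1 / 4 ≤ (∑ x ∈ winning s, ∏ i : Bool × Fin s, coinWeight (if i.1 then q else p) (x i)) *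
      (1 + (p - q) ^ 2 / (q * (1 - q))) ^ s := by
  let g : Bool × Fin s → Bool → ℝ := fun i b =>
    if i.1 then coinWeight p b ^ 2 / coinWeight q b else coinWeight p b
  have hg0 : ∀ i b, 0 ≤ g i b := by
    intro i b
    have := coinWeight_nonneg h0 h1 b
    have := coinWeight_pos hq0 hq1 b
    simp only [g]
    split_ifs <;> positivity
  have hw0 : ∀ (i : Bool × Fin s) b, 0 ≤ coinWeight (if i.1 then q else p) b := by
    intro i b
    split_ifs
    · exact (coinWeight_pos hq0 hq1 b).le
    · exact coinWeight_nonneg h0 h1 b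
  -- Cauchy–Schwarz for the change of measure: `g` is the squared old weight over the new one,
  -- coordinate by coordinate. On the second series the two weights agree.
  have hcs : (∑ x ∈ winning s, ∏ i, coinWeight p (x i)) ^ 2 ≤
      (∑ x ∈ winning s, ∏ i : Bool × Fin s, coinWeight (if i.1 then q else p) (x i)) *
        ∑ x ∈ winning s, ∏ i, g i (x i) := by
    apply Finset.sum_sq_le_sum_mul_sum_of_sq_le_mul
    · exact fun x _ => Finset.prod_nonneg fun i _ => hw0 _ _
    · exact fun x _ => Finset.prod_nonneg fun i _ => hg0 _ _
    · intro x _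
      refine le_of_eq ?_
      rw [← Finset.prod_pow, ← Finset.prod_mul_distrib]
      refine Finset.prod_congr rfl fun i _ => ?_
      have := (coinWeight_pos hq0 hq1 (x i)).ne'
      simp only [g]
      split_ifs
      · field_simp
      · ring
  -- Over all outcomes the sum factorizes: each toss of the first series contributes `1 + χ²`, each
  -- toss of the second contributes 1.
  have hgs : ∑ x ∈ winning s, ∏ i, g i (x i) ≤ (1 + (p - q) ^ 2 / (q * (1 - q))) ^ s := by
    calc ∑ x ∈ winning s, ∏ i, g i (x i) ≤ ∑ x : Bool × Fin s → Bool, ∏ i, g i (x i) :=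
          Finset.sum_le_sum_of_subset_of_nonneg (Finset.subset_univ _)
            fun x _ _ => Finset.prod_nonneg fun i _ => hg0 _ _
      _ = ∏ i, ∑ b, g i b := (Fintype.prod_sum _).symm
      _ = (1 + (p - q) ^ 2 / (q * (1 - q))) ^ s := by
          have h2 : 1 - q ≠ 0 := by linarith
          have h3 : p ^ 2 / q + (1 - p) ^ 2 / (1 - q) = 1 + (p - q) ^ 2 / (q * (1 - q)) := by
            field_simp
            ring
          simp [Fintype.prod_prod_type, g, coinWeight, h3]
  have hh := half_le_sum_winning s h0 h1
  calc (1 / 4 : ℝ) = (1 / 2) ^ 2 := by norm_num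
    _ ≤ (∑ x ∈ winning s, ∏ i, coinWeight p (x i)) ^ 2 := by gcongr
    _ ≤ _ := hcs
    _ ≤ _ := by
        gcongr
        exact Finset.sum_nonneg fun x _ => Finset.prod_nonneg fun i _ => hw0 _ _

/-! ### Independent pulls and the probability of winning a challenge -/

instance (n : ℕ) (I : BanditInstance n) (i : Fin n) : IsProbabilityMeasure (I.law i) := I.isProb i

instance (n : ℕ) (I : BanditInstance n) : IsProbabilityMeasure I.tableLaw :=
  inferInstanceAs (IsProbabilityMeasure (Measure.infinitePi _))

theorem iIndepFun_pulls {n : ℕ} (I : BanditInstance n) :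
    iIndepFun (fun (q : Pull n) (ω : RewardTable n) => ω q) I.tableLaw :=
  iIndepFun_infinitePi (P := fun q : Pull n => I.law q.arm) (X := fun _ x => x)
    fun _ => measurable_id

theorem tableLaw_real_eval {n : ℕ} (I : BanditInstance n) (q : Pull n) {t : Set ℝ}
    (ht : MeasurableSet t) :
    I.tableLaw.real {ω | ω q ∈ t} = (I.law q.arm).real t := by
  have h := Measure.infinitePi_map_eval (fun q : Pull n => I.law q.arm) q
  rw [measureReal_def, measureReal_def, ← h, Measure.map_apply (measurable_pi_apply q) ht]
  rfl

theorem tableLaw_real_pattern {n : ℕ} (I : BanditInstance n) {ι : Type*} [Fintype ι]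
    {e : ι → Pull n} (he : Function.Injective e) (p : ι → ℝ) (hp : ∀ i, p i ∈ Set.Icc (0 : ℝ) 1)
    (hlaw : ∀ i, I.law (e i).arm = bernoulliMeasure (1 : ℝ) 0 ⟨p i, hp i⟩) (x : ι → Bool) :
    I.tableLaw.real {ω | ∀ i, ω (e i) = if x i then 1 else 0} = ∏ i, coinWeight (p i) (x i) := by
  have h := ((iIndepFun_pulls I).precomp he).measure_inter_preimage_eq_mul Finset.univ
    (sets := fun i => {if x i then (1 : ℝ) else 0}) (fun i _ => measurableSet_singleton _)
  have hset : {ω : RewardTable n | ∀ i, ω (e i) = if x i then 1 else 0} =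
      ⋂ i ∈ Finset.univ, (fun ω : RewardTable n => ω (e i)) ⁻¹' {if x i then (1 : ℝ) else 0} := by
    ext ω
    simp
  rw [hset, measureReal_def, h, ENNReal.toReal_prod]
  refine Finset.prod_congr rfl fun i _ => ?_
  have h2 := tableLaw_real_eval I (e i) (measurableSet_singleton (if x i then (1 : ℝ) else 0))
  rw [hlaw] at h2
  refine Eq.trans h2 ?_
  cases hx : x i
  · rw [bernoulliMeasure_real_apply_of_notMem_of_mem] <;> simp [coinWeight]
  · rw [bernoulliMeasure_real_apply_of_mem_of_notMem] <;> simp [coinWeight]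

/-- The probability that arm `a` of mean `q` is not beaten by arm `b` of mean `p`. -/
theorem quarter_le_duel {n : ℕ} (I : BanditInstance n) {a b : Fin n} (hab : a ≠ b) {p q : ℝ}
    (hp : p ∈ Set.Icc (0 : ℝ) 1) (hq : q ∈ Set.Icc (0 : ℝ) 1) (hq0 : 0 < q) (hq1 : q < 1)
    (ha : I.law a = bernoulliMeasure (1 : ℝ) 0 ⟨q, hq⟩)
    (hb : I.law b = bernoulliMeasure (1 : ℝ) 0 ⟨p, hp⟩) (s : ℕ) (j : Fin n) (l : ℕ) :
    1 / 4 ≤ I.tableLaw.real {ω | ¬ empMean ω s j l a < empMean ω s j l b} *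
      (1 + (p - q) ^ 2 / (q * (1 - q))) ^ s := by
  have hpos : 0 < q * (1 - q) := mul_pos hq0 (by linarith)
  refine (quarter_le_sum_winning s hp.1 hp.2 hq0 hq1).trans ?_
  gcongr
  let e : Bool × Fin s → Pull n := fun i => ⟨if i.1 then a else b, j, l, i.2⟩
  have he : Function.Injective e := by
    rintro ⟨c, k⟩ ⟨c', k'⟩ h
    simp only [e, Pull.mk.injEq, true_and] at h
    obtain ⟨h1, h2⟩ := h
    have h2 : k = k' := Fin.ext h2
    subst h2
    cases c <;> cases c' <;> simp_all [hab.symm]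
  have hP : ∀ x : Bool × Fin s → Bool,
      I.tableLaw.real {ω | ∀ i, ω (e i) = if x i then 1 else 0} =
        ∏ i : Bool × Fin s, coinWeight (if i.1 then q else p) (x i) := by
    intro x
    refine tableLaw_real_pattern I he (fun i => if i.1 then q else p) ?_ ?_ x
    · rintro ⟨_ | _, k⟩
      · simpa using hp
      · simpa using hq
    · rintro ⟨_ | _, k⟩
      · simpa [e] using hb
      · simpa [e] using ha
  have hmeas : ∀ x : Bool × Fin s → Bool,
      MeasurableSet {ω : RewardTable n | ∀ i, ω (e i) = if x i then 1 else 0} := by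
    intro x
    rw [Set.ofPred_forall]
    exact MeasurableSet.iInter fun i => measurable_pi_apply (e i) (measurableSet_singleton _)
  calc ∑ x ∈ winning s, ∏ i : Bool × Fin s, coinWeight (if i.1 then q else p) (x i)
      = ∑ x ∈ winning s, I.tableLaw.real {ω | ∀ i, ω (e i) = if x i then 1 else 0} := by
        simp only [hP]
    _ = I.tableLaw.real (⋃ x ∈ winning s, {ω | ∀ i, ω (e i) = if x i then 1 else 0}) := by
        rw [measureReal_biUnion_finset]
        · intro x _ y _ hxy
          refine Set.disjoint_left.2 fun ω hx hy => hxy (funext fun i => ?_)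
          have h := (hx i).symm.trans (hy i)
          cases hxi : x i <;> cases hyi : y i <;> simp_all
        · exact fun x _ => hmeas x
    _ ≤ _ := by
        refine measureReal_mono ?_
        intro ω hω
        simp only [Set.mem_iUnion] at hω
        obtain ⟨x, hx, hω⟩ := hω
        have hsum : ∀ c : Bool, ∑ k ∈ Finset.range s, ω ⟨if c then a else b, j, l, k⟩ =
            ∑ k : Fin s, (if x (c, k) then (1 : ℝ) else 0) := by
          intro c
          rw [Finset.sum_range]
          exact Finset.sum_congr rfl fun k _ => hω (c, k)
        have h1 := hsum true
        have h2 := hsum false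
        simp only [if_true, Bool.false_eq_true, if_false] at h1 h2
        simp only [Set.mem_ofPred_eq, not_lt, empMean]
        rw [h1, h2]
        refine div_le_div_of_nonneg_right ?_ (Nat.cast_nonneg s)
        exact (Finset.mem_filter.1 hx).2

/-! ### Which pulls the memory depends on -/

/-- A function with countably many values whose level sets are all measurable. -/
structure DiscreteMeasurable {Ω α : Type*} (m : MeasurableSpace Ω) (f : Ω → α) : Prop where
  countable_range : (Set.range f).Countable
  measurable_eq : ∀ a, MeasurableSet[m] {ω | f ω = a}

namespace DiscreteMeasurable

variable {Ω α β : Type*} {m : MeasurableSpace Ω}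

theorem measurableSet {f : Ω → α} (hf : DiscreteMeasurable m f) (P : α → Prop) :
    MeasurableSet[m] {ω | P (f ω)} := by
  have h : {ω | P (f ω)} = ⋃ a ∈ Set.range f ∩ {a | P a}, {ω | f ω = a} := by
    ext ω
    simp only [Set.mem_ofPred_eq, Set.mem_iUnion, exists_prop]
    constructor
    · exact fun h => ⟨f ω, ⟨⟨ω, rfl⟩, h⟩, rfl⟩
    · rintro ⟨a, ⟨_, ha⟩, rfl⟩
      exact ha
  rw [h]
  exact MeasurableSet.biUnion (hf.countable_range.mono Set.inter_subset_left)
    fun a _ => hf.measurable_eq a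

theorem const (a : α) : DiscreteMeasurable m fun _ : Ω => a where
  countable_range := (Set.countable_singleton a).mono (by rintro _ ⟨_, rfl⟩; rfl)
  measurable_eq := fun _ => MeasurableSet.const _

/-- This handles adaptivity: which arms are sampled depends on earlier rewards, but after splitting
along the countably many values of `f` each piece is a challenge between fixed arms. No `σ`-algebra
on the type of memories is needed. -/
theorem bind {f : Ω → α} (hf : DiscreteMeasurable m f) {F : α → Ω → β}
    (hF : ∀ a, DiscreteMeasurable m (F a)) : DiscreteMeasurable m fun ω => F (f ω) ω where
  countable_range := by
    refine (hf.countable_range.biUnion fun a _ => (hF a).countable_range).mono ?_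
    rintro _ ⟨ω, rfl⟩
    exact Set.mem_biUnion ⟨ω, rfl⟩ ⟨ω, rfl⟩
  measurable_eq := fun b => by
    have h : {ω | F (f ω) ω = b} =
        ⋃ a ∈ Set.range f, {ω | f ω = a} ∩ {ω | F a ω = b} := by
      ext ω
      simp only [Set.mem_ofPred_eq, Set.mem_iUnion, Set.mem_inter_iff, exists_prop]
      exact ⟨fun h => ⟨f ω, ⟨ω, rfl⟩, rfl, h⟩, fun ⟨a, _, ha, h⟩ => ha ▸ h⟩
    rw [h]
    exact MeasurableSet.biUnion hf.countable_range
      fun a _ => (hf.measurable_eq a).inter ((hF a).measurable_eq b)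

theorem comp {f : Ω → α} (hf : DiscreteMeasurable m f) (g : α → β) :
    DiscreteMeasurable m fun ω => g (f ω) :=
  hf.bind (F := fun a _ => g a) fun a => const (g a)

theorem ite {P : Ω → Prop} [DecidablePred P] (hP : MeasurableSet[m] {ω | P ω}) {f g : Ω → α}
    (hf : DiscreteMeasurable m f) (hg : DiscreteMeasurable m g) :
    DiscreteMeasurable m fun ω => if P ω then f ω else g ω where
  countable_range := by
    refine (hf.countable_range.union hg.countable_range).mono ?_
    rintro _ ⟨ω, rfl⟩
    by_cases h : P ω
    · exact Or.inl ⟨ω, by simp [h]⟩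
    · exact Or.inr ⟨ω, by simp [h]⟩
  measurable_eq := fun a => by
    have h : {ω | (if P ω then f ω else g ω) = a} =
        ({ω | P ω} ∩ {ω | f ω = a}) ∪ ({ω | P ω}ᶜ ∩ {ω | g ω = a}) := by
      ext ω
      by_cases h : P ω <;> simp [h]
    rw [h]
    exact (hP.inter (hf.measurable_eq a)).union (hP.compl.inter (hg.measurable_eq a))

theorem mono {m' : MeasurableSpace Ω} (h : m ≤ m') {f : Ω → α} (hf : DiscreteMeasurable m f) :
    DiscreteMeasurable m' f :=
  ⟨hf.countable_range, fun a => h _ (hf.measurable_eq a)⟩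

end DiscreteMeasurable

/-- The `σ`-algebra generated by the pulls in `S`. -/
@[reducible]
def pullAlgebra {n : ℕ} (S : Set (Pull n)) : MeasurableSpace (RewardTable n) :=
  ⨆ q ∈ S, MeasurableSpace.comap (fun ω : RewardTable n => ω q) inferInstance

theorem pullAlgebra_mono {n : ℕ} {S T : Set (Pull n)} (h : S ⊆ T) :
    pullAlgebra S ≤ pullAlgebra T :=
  biSup_mono h

theorem pullAlgebra_le {n : ℕ} (S : Set (Pull n)) : pullAlgebra S ≤ MeasurableSpace.pi :=
  iSup₂_le fun q _ => (measurable_pi_apply q).comap_le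

theorem measurable_pull {n : ℕ} {S : Set (Pull n)} {q : Pull n} (hq : q ∈ S) :
    Measurable[pullAlgebra S] fun ω : RewardTable n => ω q :=
  Measurable.of_comap_le (le_biSup (fun q : Pull n =>
    MeasurableSpace.comap (fun ω : RewardTable n => ω q) inferInstance) hq)

theorem indep_pullAlgebra {n : ℕ} (I : BanditInstance n) {S T : Set (Pull n)}
    (h : Disjoint S T) : Indep (pullAlgebra S) (pullAlgebra T) I.tableLaw :=
  indep_iSup_of_disjoint (fun q => (measurable_pi_apply q).comap_le) (iIndepFun_pulls I).iIndep h

theorem measurable_empMean {n : ℕ} {S : Set (Pull n)} {j a : Fin n} {l : ℕ}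
    (h : ∀ k, (⟨a, j, l, k⟩ : Pull n) ∈ S) (s : ℕ) :
    Measurable[pullAlgebra S] fun ω : RewardTable n => empMean ω s j l a :=
  (Finset.measurable_fun_sum _ fun k _ => measurable_pull (h k)).div_const _

theorem measurableSet_duel {n : ℕ} {S : Set (Pull n)} {j : Fin n} {l : ℕ}
    (h : ∀ a k, (⟨a, j, l, k⟩ : Pull n) ∈ S) (s : ℕ) (a b : Fin n) :
    MeasurableSet[pullAlgebra S] {ω : RewardTable n | empMean ω s j l a < empMean ω s j l b} :=
  measurableSet_lt (measurable_empMean (h a) s) (measurable_empMean (h b) s)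

theorem discreteMeasurable_challenge {n : ℕ} {S : Set (Pull n)} {j : Fin n} {l : ℕ}
    (h : ∀ a k, (⟨a, j, l, k⟩ : Pull n) ∈ S) (ε δ : ℝ) (M : Memory n) (a : Fin n) :
    DiscreteMeasurable (pullAlgebra S) fun ω => challenge ε δ ω j l M a := by
  unfold challenge
  cases M.stored l with
  | none => exact .const a
  | some b => exact .ite (measurableSet_duel h _ a b) (.const b) (.const a)

theorem discreteMeasurable_promote {n : ℕ} {S : Set (Pull n)} {j : Fin n}
    (h : ∀ a l k, (⟨a, j, l, k⟩ : Pull n) ∈ S) (ε δ : ℝ) (d : ℕ) :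
    ∀ (l : ℕ) (a : Fin n) (M : Memory n),
      DiscreteMeasurable (pullAlgebra S) fun ω => promote ε δ ω j d l a M := by
  induction d with
  | zero =>
    intro l a M
    exact (discreteMeasurable_challenge (fun a k => h a l k) ε δ M a).comp (M.keep l)
  | succ d ih =>
    intro l a M
    have hc := discreteMeasurable_challenge (fun a k => h a l k) ε δ M a
    unfold promote
    split_ifs
    · exact hc.bind (F := fun w ω => promote ε δ ω j d (l + 1) w (M.clear l))
        fun w => ih (l + 1) w _
    · exact hc.comp (M.keep l)

/-- The memory after the first `k` arrivals. -/
noncomputable def memoryAfter (ε δ : ℝ) (n : ℕ) (ω : RewardTable n) (k : ℕ) : Memory n :=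
  ((List.finRange n).take k).foldl (fun M j => promote ε δ ω j (numLevels n - 1) 1 j M)
    (Memory.init n)

theorem memoryAfter_succ (ε δ : ℝ) {n : ℕ} (ω : RewardTable n) (j : Fin n) :
    memoryAfter ε δ n ω (j + 1) =
      promote ε δ ω j (numLevels n - 1) 1 j (memoryAfter ε δ n ω j) := by
  simp [memoryAfter, List.take_add_one]

theorem memoryAfter_self (ε δ : ℝ) (n : ℕ) (ω : RewardTable n) :
    memoryAfter ε δ n ω n = finalMemory ε δ n ω := by
  unfold memoryAfter finalMemory
  rw [List.take_of_length_le (by simp)]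

theorem discreteMeasurable_memoryAfter (ε δ : ℝ) (n k : ℕ) (hk : k ≤ n) :
    DiscreteMeasurable (pullAlgebra {q : Pull n | (q.time : ℕ) < k})
      fun ω => memoryAfter ε δ n ω k := by
  induction k with
  | zero => exact .const _
  | succ k ih =>
    have h := memoryAfter_succ ε δ (n := n) (j := ⟨k, hk⟩)
    simp only [h]
    refine ((ih (by omega)).mono (pullAlgebra_mono fun q hq => ?_)).bind
      (F := fun M ω => promote ε δ ω ⟨k, hk⟩ (numLevels n - 1) 1 ⟨k, hk⟩ M)
      fun M => discreteMeasurable_promote (fun a l k' => ?_) ε δ _ _ _ _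
    · exact Nat.lt_succ_of_lt hq
    · exact Nat.lt_succ_self k

/-! ### There are at least three levels -/

theorem one_le_ilog {a : ℝ} (ha : 1 ≤ a) : ∀ k, 1 ≤ ilog k a
  | 0 => ha
  | _ + 1 => le_max_right _ _

theorem logb_two_le_sub_one {x : ℝ} (hx : 2 ≤ x) : Real.logb 2 x ≤ x - 1 := by
  have h2 : Real.log x = Real.log 2 + Real.log (x / 2) := by
    rw [← Real.log_mul (by norm_num) (by positivity)]
    congr 1
    ring
  have h3 : Real.log (x / 2) ≤ x / 2 - 1 := Real.log_le_sub_one_of_pos (by positivity)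
  have h4 : (0.6931471803 : ℝ) < Real.log 2 := Real.log_two_gt_d9
  rw [Real.logb, div_le_iff₀ (by linarith)]
  nlinarith

/-- A value at most 2 is followed by 1, and a value above 2 drops by at least 1 at the next step, so
the iteration cannot stay above 2. This rules out the default value of `sInf ∅` in `logStar`. -/
theorem exists_ilog_eq_one {a : ℝ} (ha : 1 ≤ a) : ∃ k, ilog k a = 1 := by
  by_contra! h
  have hgt : ∀ k, 2 < ilog k a := by
    intro k
    by_contra! hle
    refine h (k + 1) (max_eq_right ?_)
    rw [Real.logb_le_iff_le_rpow (by norm_num) (by linarith [one_le_ilog ha k])]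
    simpa using hle
  have hdec : ∀ k : ℕ, ilog k a ≤ a - k := by
    intro k
    induction k with
    | zero => simp [ilog]
    | succ k ih =>
      have h1 := logb_two_le_sub_one (hgt k).le
      have h2 : ilog (k + 1) a ≤ ilog k a - 1 := max_le h1 (by linarith [hgt k])
      push_cast
      linarith
  obtain ⟨k, hk⟩ := exists_nat_gt a
  linarith [hdec k, hgt k]

/-- Guarantees `numLevels n ≥ 3`, so level 2 is not the top level and does give up its arm when its
counter is full. -/
theorem two_le_logStar {n : ℕ} (hn : 4 < n) : 2 ≤ logStar n := by
  have hn' : (4 : ℝ) < n := by exact_mod_cast hn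
  have hlog : 2 < Real.logb 2 n := by
    rw [Real.lt_logb_iff_rpow_lt (by norm_num) (by positivity)]
    norm_num
    exact hn
  have hmem : ilog (logStar n) (n : ℝ) = 1 :=
    Nat.sInf_mem (s := {k : ℕ | ilog k (n : ℝ) = 1}) (exists_ilog_eq_one (by linarith))
  by_contra! hlt
  interval_cases h : logStar n
  · simp only [ilog] at hmem
    linarith
  · have : Real.logb 2 n ≤ ilog 1 n := le_max_left _ _
    linarith

/-! ### Evolution of the memory along the stream -/

section Dynamics

variable {n : ℕ} {ε δ : ℝ}

theorem challenge_of_none {ω : RewardTable n} {j a : Fin n} {l : ℕ} {M : Memory n}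
    (h : M.stored l = none) : challenge ε δ ω j l M a = a := by
  simp [challenge, h]

theorem challenge_mem {B : Set (Fin n)} {ω : RewardTable n} {j a : Fin n} {l : ℕ} {M : Memory n}
    (hM : ∀ b, M.stored l = some b → b ∈ B) (ha : a ∈ B) : challenge ε δ ω j l M a ∈ B := by
  unfold challenge
  cases h : M.stored l with
  | none => exact ha
  | some b =>
    dsimp only
    split_ifs
    · exact hM b h
    · exact ha

theorem challenge_congr {ω : RewardTable n} {j a : Fin n} {l : ℕ} {M M' : Memory n}
    (h : M.stored l = M'.stored l) : challenge ε δ ω j l M a = challenge ε δ ω j l M' a := by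
  simp only [challenge, h]

theorem stored_keep_mem {B : Set (Fin n)} {M : Memory n} {l : ℕ} {w : Fin n} (hw : w ∈ B)
    (hM : ∀ l b, M.stored l = some b → b ∈ B) :
    ∀ l' b, (M.keep l w).stored l' = some b → b ∈ B := by
  intro l' b h
  by_cases hl : l' = l
  · subst hl
    simp only [Memory.keep, Function.update_self, Option.some.injEq] at h
    exact h ▸ hw
  · simp only [Memory.keep, Function.update_of_ne hl] at h
    exact hM l' b h

theorem stored_clear_mem {B : Set (Fin n)} {M : Memory n} {l : ℕ}
    (hM : ∀ l b, M.stored l = some b → b ∈ B) :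
    ∀ l' b, (M.clear l).stored l' = some b → b ∈ B := by
  intro l' b h
  by_cases hl : l' = l
  · subst hl
    simp [Memory.clear] at h
  · simp only [Memory.clear, Function.update_of_ne hl] at h
    exact hM l' b h

/-- Processing an arrival only moves or drops arms, so any set containing the memory and the new arm
still contains the memory. Applied below to a tail of the stream. -/
theorem stored_promote_mem {B : Set (Fin n)} {ω : RewardTable n} {j : Fin n} (d : ℕ) :
    ∀ {l : ℕ} {a : Fin n} {M : Memory n}, a ∈ B → (∀ l b, M.stored l = some b → b ∈ B) →
      ∀ l' b, (promote ε δ ω j d l a M).stored l' = some b → b ∈ B := by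
  induction d with
  | zero => exact fun ha hM => stored_keep_mem (challenge_mem (hM _) ha) hM
  | succ d ih =>
    intro l a M ha hM
    have hc := challenge_mem (ε := ε) (δ := δ) (ω := ω) (j := j) (hM l) ha
    unfold promote
    split_ifs
    · exact ih hc (stored_clear_mem hM)
    · exact stored_keep_mem hc hM

theorem exists_stored_promote {ω : RewardTable n} {j : Fin n} (d : ℕ) :
    ∀ {l : ℕ} {a : Fin n} {M : Memory n},
      ∃ l' b, l ≤ l' ∧ l' ≤ l + d ∧ (promote ε δ ω j d l a M).stored l' = some b := by
  induction d with
  | zero => exact fun {l a M} => ⟨l, _, le_rfl, le_rfl, by simp [promote, Memory.keep]; rfl⟩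
  | succ d ih =>
    intro l a M
    unfold promote
    split_ifs
    · obtain ⟨l', b, h1, h2, h3⟩ :=
        @ih (l + 1) (challenge ε δ ω j l M a) (M.clear l)
      exact ⟨l', b, by omega, by omega, h3⟩
    · exact ⟨l, _, le_rfl, by omega, by simp [Memory.keep]; rfl⟩

theorem exists_topArm {M : Memory n} (t : ℕ) :
    ∀ {l : ℕ} {b : Fin n}, 1 ≤ l → l ≤ t → M.stored l = some b →
      ∃ l' b', M.stored l' = some b' ∧ M.topArm t = some b' := by
  induction t with
  | zero => intros; omega
  | succ t ih =>
    intro l b h1 h2 h3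
    unfold Memory.topArm
    cases h : M.stored (t + 1) with
    | some a => exact ⟨t + 1, a, h, rfl⟩
    | none =>
      have : l ≠ t + 1 := by
        rintro rfl
        simp [h] at h3
      exact ih h1 (by omega) h3

theorem exists_assadiOutput (ω : RewardTable n) (hn : 0 < n) :
    ∃ l a, (finalMemory ε δ n ω).stored l = some a ∧ assadiOutput ε δ n ω = some a := by
  obtain ⟨m, rfl⟩ : ∃ m, n = m + 1 := ⟨n - 1, by omega⟩
  have h := memoryAfter_succ ε δ ω (Fin.last m)
  rw [Fin.val_last, memoryAfter_self] at h
  obtain ⟨l, b, h1, h2, h3⟩ := exists_stored_promote (ε := ε) (δ := δ) (ω := ω)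
    (j := Fin.last m) (numLevels (m + 1) - 1) (l := 1) (a := Fin.last m)
    (M := memoryAfter ε δ (m + 1) ω (Fin.last m))
  rw [Fin.val_last, ← h] at h3
  refine exists_topArm _ h1 ?_ h3
  simp only [numLevels] at h2 ⊢
  omega

/-- The shape of the memory after `i` arrivals, as long as no arm has reached level `3`. -/
structure EarlyShape (i : ℕ) (M : Memory n) : Prop where
  count_one : M.count 1 = i % 16
  count_two : M.count 2 = i / 16
  stored_one : ∀ a, M.stored 1 = some a → (a : ℕ) / 16 = i / 16 ∧ i % 16 ≠ 0
  stored_two : i / 16 = 0 → M.stored 2 = none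
  stored_ge_three : ∀ l, l ≠ 1 → l ≠ 2 → M.stored l = none

theorem earlyShape_init : EarlyShape 0 (Memory.init n) := by
  constructor <;> simp [Memory.init]

/-- The arm that survives the challenge at level `1` when arm `j` arrives. -/
noncomputable def firstWinner (ε δ : ℝ) (ω : RewardTable n) (j : Fin n) : Fin n :=
  challenge ε δ ω j 1 (memoryAfter ε δ n ω j) j

/-- The arm that survives the challenge at level `2` if one takes place when arm `j` arrives. -/
noncomputable def secondWinner (ε δ : ℝ) (ω : RewardTable n) (j : Fin n) : Fin n :=
  challenge ε δ ω j 2 (memoryAfter ε δ n ω j) (firstWinner ε δ ω j)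

theorem memoryAfter_succ_of_mod_ne {ω : RewardTable n} (hn : 4 < n) {j : Fin n}
    (hM : EarlyShape j (memoryAfter ε δ n ω j)) (hj : (j : ℕ) % 16 ≠ 15) :
    memoryAfter ε δ n ω (j + 1) = (memoryAfter ε δ n ω j).keep 1 (firstWinner ε δ ω j) := by
  obtain ⟨d, hd⟩ : ∃ d, numLevels n - 1 = d + 1 :=
    ⟨logStar n - 1, by have := two_le_logStar hn; simp only [numLevels]; omega⟩
  rw [memoryAfter_succ, hd, promote, if_neg, firstWinner]
  rw [hM.count_one, cLevel_one]
  omega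

theorem memoryAfter_succ_of_mod_eq {ω : RewardTable n} (hn : 4 < n) {j : Fin n}
    (hM : EarlyShape j (memoryAfter ε δ n ω j)) (hj : (j : ℕ) % 16 = 15)
    (hj' : (j : ℕ) + 1 < 524288) :
    memoryAfter ε δ n ω (j + 1) =
      ((memoryAfter ε δ n ω j).clear 1).keep 2 (secondWinner ε δ ω j) := by
  obtain ⟨d, hd⟩ : ∃ d, numLevels n - 1 = d + 1 + 1 :=
    ⟨logStar n - 2, by have := two_le_logStar hn; simp only [numLevels]; omega⟩
  rw [memoryAfter_succ, hd, promote, if_pos, promote, if_neg, secondWinner, firstWinner]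
  · rw [challenge_congr (M' := memoryAfter ε δ n ω j)]
    simp [Memory.clear]
  · simp only [Memory.clear, Function.update_of_ne (show 2 ≠ 1 by decide)]
    rw [hM.count_two, show 1 + 1 = 2 from rfl, cLevel_two]
    omega
  · rw [hM.count_one, cLevel_one]
    omega

/-- Arm 524287 is the last of the `16 * 32768` arms of the blocks. Its arrival fills both counters
at once and empties levels 1 and 2. -/
theorem memoryAfter_succ_of_eq {ω : RewardTable n} (hn : 4 < n) {j : Fin n}
    (hM : EarlyShape j (memoryAfter ε δ n ω j)) (hj : (j : ℕ) = 524287) :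
    memoryAfter ε δ n ω (j + 1) =
      promote ε δ ω j (numLevels n - 3) 3 (secondWinner ε δ ω j)
        (((memoryAfter ε δ n ω j).clear 1).clear 2) := by
  obtain ⟨d, hd, hd'⟩ : ∃ d, numLevels n - 1 = d + 1 + 1 ∧ numLevels n - 3 = d :=
    ⟨logStar n - 2, by have := two_le_logStar hn; simp only [numLevels]; omega⟩
  rw [memoryAfter_succ, hd, hd', promote, if_pos, promote, if_pos, secondWinner, firstWinner]
  · rw [challenge_congr (M := (memoryAfter ε δ n ω j).clear 1) (M' := memoryAfter ε δ n ω j)]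
    simp [Memory.clear]
  · simp only [Memory.clear, Function.update_of_ne (show 2 ≠ 1 by decide)]
    rw [hM.count_two, show 1 + 1 = 2 from rfl, cLevel_two]
    omega
  · rw [hM.count_one, cLevel_one]
    omega

theorem firstWinner_div {ω : RewardTable n} {j : Fin n}
    (hM : EarlyShape j (memoryAfter ε δ n ω j)) :
    (firstWinner ε δ ω j : ℕ) / 16 = (j : ℕ) / 16 :=
  challenge_mem (B := {a | (a : ℕ) / 16 = (j : ℕ) / 16})
    (fun b hb => (hM.stored_one b hb).1) rfl

theorem earlyShape_memoryAfter (ω : RewardTable n) (hn : 4 < n) {i : ℕ} (hi : i < 524288)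
    (hin : i ≤ n) : EarlyShape i (memoryAfter ε δ n ω i) := by
  induction i with
  | zero => exact earlyShape_init
  | succ i ih =>
    have hM := ih (by omega) (by omega)
    let j : Fin n := ⟨i, hin⟩
    by_cases hj : i % 16 = 15
    · have h := memoryAfter_succ_of_mod_eq hn (j := j) hM hj hi
      rw [show i + 1 = (j : ℕ) + 1 from rfl, h]
      constructor
      · simp [Memory.keep, Memory.clear, j]
        omega
      · simp [Memory.keep, Memory.clear, j, hM.count_two]
        omega
      · simp [Memory.keep, Memory.clear]
      · simp only [j]
        omega
      · intro l h1 h2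
        simp [Memory.keep, Memory.clear, h1, h2, j, hM.stored_ge_three l h1 h2]
    · have h := memoryAfter_succ_of_mod_ne hn (j := j) hM hj
      have hw := firstWinner_div (j := j) hM
      rw [show i + 1 = (j : ℕ) + 1 from rfl, h]
      constructor
      · simp [Memory.keep, j, hM.count_one]
        omega
      · simp [Memory.keep, j, hM.count_two]
        omega
      · intro a ha
        simp only [Memory.keep, Function.update_self, Option.some.injEq] at ha
        subst ha
        simp only [j] at hw ⊢
        omega
      · intro h0
        simp only [Memory.keep, Function.update_of_ne (show 2 ≠ 1 by decide)]
        exact hM.stored_two (by simp only [j] at h0; omega)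
      · intro l h1 h2
        simp [Memory.keep, h1, j, hM.stored_ge_three l h1 h2]

/-- The last arm of block `m`. -/
def blockEnd (hn : 524288 < n) (m : ℕ) (hm : m < 32768) : Fin n := ⟨16 * m + 15, by omega⟩

/-- Level 2 changes only when a block ends, so the survivor of block `m` is still there when the
survivor of block `m + 1` challenges it; that is the case `r = 15`. -/
theorem stored_two_memoryAfter (ω : RewardTable n) (hn : 524288 < n) {m : ℕ} (hm : m + 1 < 32768)
    {r : ℕ} (hr : r < 16) :
    (memoryAfter ε δ n ω (16 * (m + 1) + r)).stored 2 =
      some (secondWinner ε δ ω (blockEnd hn m (by omega))) := by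
  induction r with
  | zero =>
    have h := memoryAfter_succ_of_mod_eq (ε := ε) (δ := δ) (ω := ω) (by omega)
      (j := blockEnd hn m (by omega))
      (earlyShape_memoryAfter ω (by omega) (by simp only [blockEnd]; omega) (Fin.is_lt _).le)
      (by simp only [blockEnd]; omega) (by simp only [blockEnd]; omega)
    rw [show 16 * (m + 1) + 0 = (blockEnd hn m (by omega) : ℕ) + 1 by simp only [blockEnd]; omega,
      h]
    simp [Memory.keep]
  | succ r ih =>
    have h := memoryAfter_succ_of_mod_ne (ε := ε) (δ := δ) (ω := ω) (by omega)
      (j := ⟨16 * (m + 1) + r, by omega⟩)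
      (earlyShape_memoryAfter ω (by omega) (by simp only; omega) (Fin.is_lt _).le)
      (by simp only; omega)
    simp only at h
    rw [← add_assoc, h]
    simpa [Memory.keep] using ih (by omega)

theorem secondWinner_zero_div (ω : RewardTable n) (hn : 524288 < n) :
    (secondWinner ε δ ω (blockEnd hn 0 (by omega)) : ℕ) / 16 = 0 := by
  have hM := earlyShape_memoryAfter (ε := ε) (δ := δ) ω (i := blockEnd hn 0 (by omega)) (by omega)
    (by simp [blockEnd]) (Fin.is_lt _).le
  rw [secondWinner, challenge_of_none (hM.stored_two (by simp [blockEnd])), firstWinner_div hM]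
  simp [blockEnd]

/-- Here `524272 = 16 * 32767` is the first arm of the last block. Once levels 1 and 2 are emptied,
the only arm in memory is the level-2 survivor, and all later arrivals have larger indices. -/
theorem le_of_stored_memoryAfter (ω : RewardTable n) (hn : 524288 < n)
    (hw : 524272 ≤ (secondWinner ε δ ω (blockEnd hn 32767 (by omega)) : ℕ)) {i : ℕ}
    (hi : 524288 ≤ i) (hin : i ≤ n) :
    ∀ l a, (memoryAfter ε δ n ω i).stored l = some a → 524272 ≤ (a : ℕ) := by
  induction i, hi using Nat.le_induction with
  | base =>
    have hM := earlyShape_memoryAfter (ε := ε) (δ := δ) ω (i := blockEnd hn 32767 (by omega))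
      (by omega) (by simp [blockEnd]) (Fin.is_lt _).le
    have h := memoryAfter_succ_of_eq (by omega) hM (by simp [blockEnd])
    rw [show 524288 = (blockEnd hn 32767 (by omega) : ℕ) + 1 by simp [blockEnd], h]
    refine stored_promote_mem (B := {a | 524272 ≤ (a : ℕ)}) _ hw ?_
    intro l b hb
    by_cases h1 : l = 1
    · simp [Memory.clear, h1] at hb
    by_cases h2 : l = 2
    · simp [Memory.clear, h2] at hb
    simp [Memory.clear, h1, h2, hM.stored_ge_three l h1 h2] at hb
  | succ i hi ih =>
    have h := memoryAfter_succ ε δ ω (⟨i, hin⟩ : Fin n)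
    simp only at h
    rw [h]
    exact stored_promote_mem (B := {a | 524272 ≤ (a : ℕ)}) _
      (by simp only [Set.mem_ofPred_eq]; omega) (ih (by omega))

end Dynamics

/-! ### The chain of wins at level 2 -/

theorem discreteMeasurable_firstWinner_stored (ε δ : ℝ) {n : ℕ} (j : Fin n) :
    DiscreteMeasurable (pullAlgebra {q : Pull n | q.time < j ∨ q.level = 1})
      fun ω => (firstWinner ε δ ω j, (memoryAfter ε δ n ω j).stored 2) := by
  have hM := (discreteMeasurable_memoryAfter ε δ n j (Fin.is_lt j).le).mono
    (pullAlgebra_mono (T := {q : Pull n | q.time < j ∨ q.level = 1}) fun q hq => Or.inl hq)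
  exact hM.bind (F := fun M ω => (challenge ε δ ω j 1 M j, M.stored 2)) fun M =>
    (discreteMeasurable_challenge (fun _ _ => Or.inr rfl) ε δ M j).comp fun w => (w, M.stored 2)

/-- If the level-`2` survivor of block `m` is from block `m`, then so it is for block `m + 1` with
conditional probability at least `ρ`, where `ρ` bounds from below the probability that an arm of
block `m + 1` is not beaten by an arm of block `m`. -/
theorem mul_secondWinner_le (ε δ : ℝ) {n : ℕ} (I : BanditInstance n) (hn : 524288 < n) {m : ℕ}
    (hm : m + 1 < 32768) {ρ : ℝ}
    (hρ : ∀ a b : Fin n, (a : ℕ) / 16 = m + 1 → (b : ℕ) / 16 = m →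
      ρ ≤ I.tableLaw.real {ω | ¬ empMean ω (sLevel ε δ 2) (blockEnd hn (m + 1) hm) 2 a <
        empMean ω (sLevel ε δ 2) (blockEnd hn (m + 1) hm) 2 b}) :
    ρ * I.tableLaw.real {ω | (secondWinner ε δ ω (blockEnd hn m (by omega)) : ℕ) / 16 = m} ≤
      I.tableLaw.real {ω | (secondWinner ε δ ω (blockEnd hn (m + 1) hm) : ℕ) / 16 = m + 1} := by
  set J := blockEnd hn (m + 1) hm
  let f : RewardTable n → Fin n × Option (Fin n) :=
    fun ω => (firstWinner ε δ ω J, (memoryAfter ε δ n ω J).stored 2)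
  let W : Fin n × Fin n → Set (RewardTable n) := fun c =>
    {ω | ¬ empMean ω (sLevel ε δ 2) J 2 c.1 < empMean ω (sLevel ε δ 2) J 2 c.2}
  let E : Fin n × Fin n → Set (RewardTable n) := fun c => {ω | f ω = (c.1, some c.2)}
  let Q : Finset (Fin n × Fin n) :=
    Finset.univ.filter fun c => (c.1 : ℕ) / 16 = m + 1 ∧ (c.2 : ℕ) / 16 = m
  have hstored : ∀ ω, (memoryAfter ε δ n ω J).stored 2 =
      some (secondWinner ε δ ω (blockEnd hn m (by omega))) :=
    fun ω => stored_two_memoryAfter ω hn hm (r := 15) (by omega)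
  have hfirst : ∀ ω, (firstWinner ε δ ω J : ℕ) / 16 = m + 1 := by
    intro ω
    rw [firstWinner_div (earlyShape_memoryAfter ω (by omega)
      (by simp only [J, blockEnd]; omega) (Fin.is_lt J).le)]
    simp only [J, blockEnd]
    omega
  have hEm : ∀ c, MeasurableSet[pullAlgebra {q : Pull n | q.time < J ∨ q.level = 1}] (E c) :=
    fun c => (discreteMeasurable_firstWinner_stored ε δ J).measurable_eq _
  have hWm : ∀ c, MeasurableSet[pullAlgebra {q : Pull n | q.time = J ∧ q.level = 2}] (W c) :=
    fun c => (measurableSet_duel (S := {q : Pull n | q.time = J ∧ q.level = 2})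
      (fun _ _ => ⟨rfl, rfl⟩) _ c.1 c.2).compl
  -- The contestants are determined by earlier pulls and by pulls at level 1, whereas the duel uses
  -- only level-2 pulls at the current time. This disjointness yields the independence.
  have hdisj : Disjoint {q : Pull n | q.time < J ∨ q.level = 1}
      {q : Pull n | q.time = J ∧ q.level = 2} := by
    refine Set.disjoint_left.2 ?_
    rintro q (h | h) ⟨h1, h2⟩
    · exact h.ne h1
    · omega
  have hind : ∀ c, I.tableLaw.real (E c ∩ W c) = I.tableLaw.real (E c) * I.tableLaw.real (W c) := by
    intro c
    rw [measureReal_def, (Indep_iff _ _ _).1 (indep_pullAlgebra I hdisj) _ _ (hEm c) (hWm c),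
      ENNReal.toReal_mul]
    rfl
  have hEdisj : ∀ c c' ω, ω ∈ E c → ω ∈ E c' → c = c' := by
    intro c c' ω h h'
    have := h.symm.trans h'
    simp only [Prod.mk.injEq, Option.some.injEq] at this
    exact Prod.ext this.1 this.2
  have hH : {ω | (secondWinner ε δ ω (blockEnd hn m (by omega)) : ℕ) / 16 = m} ⊆
      ⋃ c ∈ Q, E c := by
    intro ω hω
    simp only [Set.mem_iUnion]
    refine ⟨(firstWinner ε δ ω J, secondWinner ε δ ω (blockEnd hn m (by omega))), ?_, ?_⟩
    · simpa [Q, hfirst] using hω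
    · simp [E, f, hstored]
  calc ρ * I.tableLaw.real {ω | (secondWinner ε δ ω (blockEnd hn m (by omega)) : ℕ) / 16 = m}
      ≤ ∑ c ∈ Q, I.tableLaw.real (E c ∩ W c) := by
        -- The sign of `ρ` is not assumed; a nonpositive `ρ` makes the bound trivial.
        rcases le_or_gt ρ 0 with h | h
        · exact (mul_nonpos_of_nonpos_of_nonneg h measureReal_nonneg).trans
            (Finset.sum_nonneg fun _ _ => measureReal_nonneg)
        · calc ρ * I.tableLaw.real _ ≤ ρ * ∑ c ∈ Q, I.tableLaw.real (E c) := by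
                gcongr
                exact (measureReal_mono hH (measure_ne_top _ _)).trans (measureReal_biUnion_finset_le _ _)
            _ ≤ _ := by
                rw [Finset.mul_sum]
                refine Finset.sum_le_sum fun c hc => ?_
                rw [hind, mul_comm]
                have hc := (Finset.mem_filter.1 hc).2
                gcongr
                exact hρ c.1 c.2 hc.1 hc.2
    _ = I.tableLaw.real (⋃ c ∈ Q, E c ∩ W c) := by
        rw [measureReal_biUnion_finset]
        · intro c _ c' _ hcc
          exact Set.disjoint_left.2 fun ω h h' => hcc (hEdisj c c' ω h.1 h'.1)
        · exact fun c _ => (pullAlgebra_le _ _ (hEm c)).inter (pullAlgebra_le _ _ (hWm c))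
    _ ≤ _ := by
        refine measureReal_mono ?_
        intro ω hω
        simp only [Set.mem_iUnion] at hω
        obtain ⟨c, hc, hE, hW⟩ := hω
        have hc := (Finset.mem_filter.1 hc).2
        simp only [E, f, Set.mem_ofPred_eq, Prod.mk.injEq] at hE
        have hs : secondWinner ε δ ω J = c.1 := by
          rw [secondWinner, challenge, hE.2, hE.1]
          exact if_neg hW
        rw [Set.mem_ofPred_eq, hs]
        exact hc.1

theorem pow_le_secondWinner (ε δ : ℝ) {n : ℕ} (I : BanditInstance n) (hn : 524288 < n) {ρ : ℝ}
    (hρ0 : 0 ≤ ρ)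
    (hρ : ∀ (m : ℕ) (a b j : Fin n), m + 1 < 32768 → (a : ℕ) / 16 = m + 1 → (b : ℕ) / 16 = m →
      ρ ≤ I.tableLaw.real
        {ω | ¬ empMean ω (sLevel ε δ 2) j 2 a < empMean ω (sLevel ε δ 2) j 2 b})
    (m : ℕ) (hm : m < 32768) :
    ρ ^ m ≤ I.tableLaw.real {ω | (secondWinner ε δ ω (blockEnd hn m hm) : ℕ) / 16 = m} := by
  induction m with
  | zero => simp [secondWinner_zero_div]
  | succ m ih =>
    rw [pow_succ']
    exact (mul_le_mul_of_nonneg_left (ih (by omega)) hρ0).trans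
      (mul_secondWinner_le ε δ I hn hm fun a b ha hb => hρ m a b _ hm ha hb)

/-! ### Numerical bounds on the adversarial stream -/

theorem sLevel_two_le {ε δ : ℝ} (hε : 0 < ε) (hL : 0 ≤ Real.log (1 / δ)) :
    (sLevel ε δ 2 : ℝ) ≤ 1600 / ε ^ 2 * (Real.log (1 / δ) + 48) + 1 := by
  have h : 4 * betaLevel ε 2 * (Real.log (1 / δ) + 3 * (rLevel 2 : ℝ)) =
      1600 / ε ^ 2 * (Real.log (1 / δ) + 48) := by
    simp only [betaLevel, epsLevel, rLevel]
    field_simp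
    norm_num
  rw [sLevel, h]
  exact (Nat.ceil_lt_add_one (by positivity)).le

theorem advMean_of_div {ε : ℝ} {i m : ℕ} (hm : m < 32768) (hi : i / 16 = m) :
    advMean ε i = 1 / 2 - m * (ε / 32766) := by
  rw [advMean, cLevel_one, cLevel_two, if_pos (by omega), hi]
  norm_num

/-- The term `-2` absorbs the factor `1 / 4 ≥ exp (-2)`. The constant 8004 comes from `8000 (L + 48)
+ 5 ε ^ 2 ≤ 8004 L`, valid since `8000 * 48 = 384000` is below `4 L` by more than `5 ε ^ 2`. -/
theorem exp_le_duel {ε δ : ℝ} (h0 : 0 < ε) (h1 : ε < 1 / 5) (hL : 100000 ≤ Real.log (1 / δ))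
    {n m : ℕ} {a b j : Fin n} (hm : m + 1 < 32768) (ha : (a : ℕ) / 16 = m + 1)
    (hb : (b : ℕ) / 16 = m) :
    Real.exp (-2 - 8004 / 32766 ^ 2 * Real.log (1 / δ)) ≤ (advInstance n ε h0 h1).tableLaw.real
      {ω | ¬ empMean ω (sLevel ε δ 2) j 2 a < empMean ω (sLevel ε δ 2) j 2 b} := by
  set L := Real.log (1 / δ) with hLdef
  have hq := advMean_of_div (ε := ε) hm ha
  have hp := advMean_of_div (ε := ε) (by omega) hb
  have hmR : (m : ℝ) + 1 ≤ 32767 := by exact_mod_cast (by omega : m + 1 ≤ 32767)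
  have hm0 : (0 : ℝ) ≤ m := Nat.cast_nonneg m
  push_cast at hq
  have hq1 : 29 / 100 ≤ advMean ε a := by
    have : ((m : ℝ) + 1) * (ε / 32766) ≤ 32767 * (ε / 32766) := by gcongr
    rw [hq]
    linarith
  have hq2 : advMean ε a ≤ 1 / 2 := by
    have : 0 ≤ ((m : ℝ) + 1) * (ε / 32766) := by positivity
    rw [hq]
    linarith
  have hd := quarter_le_duel (advInstance n ε h0 h1) (a := a) (b := b)
    (by rintro rfl; omega) (advMean_mem h0 h1 b) (advMean_mem h0 h1 a) (by linarith)
    (by linarith) rfl rfl (sLevel ε δ 2) j 2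
  set P := (advInstance n ε h0 h1).tableLaw.real
    {ω | ¬ empMean ω (sLevel ε δ 2) j 2 a < empMean ω (sLevel ε δ 2) j 2 b}
  have hgap : advMean ε b - advMean ε a = ε / 32766 := by
    rw [hp, hq]
    ring
  -- The mean lies in `[0.29, 0.5]`, so the variance is at least `0.29 * 0.71 > 1 / 5`; this is the
  -- source of the factor 5 below.
  have hvar : 1 / 5 ≤ advMean ε a * (1 - advMean ε a) := by nlinarith
  have hchi : (advMean ε b - advMean ε a) ^ 2 / (advMean ε a * (1 - advMean ε a)) ≤
      5 * (ε / 32766) ^ 2 := by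
    rw [hgap, div_le_iff₀ (by linarith)]
    nlinarith [sq_nonneg (ε / 32766)]
  have hpow : (1 + (advMean ε b - advMean ε a) ^ 2 / (advMean ε a * (1 - advMean ε a))) ^
      sLevel ε δ 2 ≤ Real.exp (8004 / 32766 ^ 2 * L) := by
    calc _ ≤ (Real.exp (5 * (ε / 32766) ^ 2)) ^ sLevel ε δ 2 := by
          have : 0 ≤ (advMean ε b - advMean ε a) ^ 2 / (advMean ε a * (1 - advMean ε a)) :=
            div_nonneg (sq_nonneg _) (by linarith)
          gcongr
          linarith [Real.add_one_le_exp (5 * (ε / 32766) ^ 2)]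
      _ = Real.exp (sLevel ε δ 2 * (5 * (ε / 32766) ^ 2)) := (Real.exp_nat_mul _ _).symm
      _ ≤ Real.exp ((1600 / ε ^ 2 * (L + 48) + 1) * (5 * (ε / 32766) ^ 2)) := by
          gcongr
          exact sLevel_two_le h0 (by linarith)
      _ ≤ _ := by
          refine Real.exp_le_exp.2 ?_
          have h : (1600 / ε ^ 2 * (L + 48) + 1) * (5 * (ε / 32766) ^ 2) =
              (8000 * (L + 48) + 5 * ε ^ 2) / 32766 ^ 2 := by
            field_simp
            ring
          rw [h, div_mul_eq_mul_div]
          gcongr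
          nlinarith
  have hP0 : 0 ≤ P := measureReal_nonneg
  have h4 : 4 ≤ Real.exp 2 := by
    rw [show (2 : ℝ) = 1 + 1 by norm_num, Real.exp_add]
    nlinarith [Real.add_one_le_exp 1]
  have h5 : 1 / 4 ≤ P * Real.exp (8004 / 32766 ^ 2 * L) :=
    hd.trans (mul_le_mul_of_nonneg_left hpow hP0)
  rw [Real.exp_sub, Real.exp_neg, div_le_iff₀ (Real.exp_pos _)]
  refine le_trans ?_ h5
  rw [one_div]
  exact inv_anti₀ (by norm_num) h4

theorem mean_advInstance {ε : ℝ} (h0 : 0 < ε) (h1 : ε < 1 / 5) {n : ℕ} (i : Fin n) :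
    (advInstance n ε h0 h1).mean i = advMean ε i := by
  simp [BanditInstance.mean, advInstance, integral_bernoulliMeasure]

theorem not_isEpsBest_advInstance {ε : ℝ} (h0 : 0 < ε) (h1 : ε < 1 / 5) {n : ℕ} {i : Fin n}
    (hi : 524272 ≤ (i : ℕ)) : ¬ (advInstance n ε h0 h1).IsEpsBest ε i := by
  have hsup : 1 / 2 ≤ ⨆ j, (advInstance n ε h0 h1).mean j := by
    refine le_trans ?_ (le_ciSup (Set.finite_range _).bddAbove (⟨0, by omega⟩ : Fin n))
    rw [mean_advInstance, advMean_of_div (m := 0) (by omega) (by simp)]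
    simp
  -- In the last block the deficit is `32767 / 32766 * ε > ε`; beyond it the mean is 0, below `1 / 2
  -- - ε` because `ε < 1 / 5`.
  have hmean : advMean ε i < 1 / 2 - ε := by
    by_cases h : (i : ℕ) < 524288
    · rw [advMean_of_div (m := 32767) (by omega) (by omega)]
      push_cast
      linarith
    · rw [advMean, cLevel_one, cLevel_two, if_neg (by omega)]
      linarith
  rw [BanditInstance.IsEpsBest, mean_advInstance]
  linarith

theorem lt_secondWinner {ε δ : ℝ} (h0 : 0 < ε) (h1 : ε < 1 / 5) (hδ : 0 < δ)
    (hL : 100000 ≤ Real.log (1 / δ)) {n : ℕ} (hn : 524288 < n) :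
    δ < (advInstance n ε h0 h1).tableLaw.real
      {ω | (secondWinner ε δ ω (blockEnd hn 32767 (by omega)) : ℕ) / 16 = 32767} := by
  refine lt_of_lt_of_le ?_ (pow_le_secondWinner ε δ (advInstance n ε h0 h1) hn
    (Real.exp_pos (-2 - 8004 / 32766 ^ 2 * Real.log (1 / δ))).le
    (fun m a b j hm ha hb => exp_le_duel h0 h1 hL hm ha hb) 32767 (by omega))
  rw [← Real.exp_nat_mul]
  have hδ' : δ = Real.exp (-Real.log (1 / δ)) := by
    rw [one_div, Real.log_inv, neg_neg, Real.exp_log hδ]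
  conv_lhs => rw [hδ']
  rw [Real.exp_lt_exp]
  push_cast
  -- The coefficient `32767 * 8004 / 32766 ^ 2` is below `0.245`, so it remains that `0.755 L >
  -- 65534`, which follows from `L ≥ 100000`.
  linarith

/-! ### Failure of the algorithm -/

theorem lt_no_best_stored {ε δ : ℝ} (h0 : 0 < ε) (h1 : ε < 1 / 5) (hδ : 0 < δ)
    (hL : 100000 ≤ Real.log (1 / δ)) {n : ℕ} (hn : 524288 < n) :
    δ < (advInstance n ε h0 h1).tableLaw.real
      {ω | ∀ l a, (finalMemory ε δ n ω).stored l = some a →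
        ¬ (advInstance n ε h0 h1).IsEpsBest ε a} := by
  refine (lt_secondWinner h0 h1 hδ hL hn).trans_le (measureReal_mono ?_)
  intro ω hω l a h
  rw [← memoryAfter_self] at h
  simp only [Set.mem_ofPred_eq] at hω
  exact not_isEpsBest_advInstance h0 h1
    (le_of_stored_memoryAfter ω hn (by omega) hn.le le_rfl l a h)

theorem lt_output_not_best {ε δ : ℝ} (h0 : 0 < ε) (h1 : ε < 1 / 5) (hδ : 0 < δ)
    (hL : 100000 ≤ Real.log (1 / δ)) {n : ℕ} (hn : 524288 < n) :
    δ < (advInstance n ε h0 h1).tableLaw.real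
      {ω | ∃ a, assadiOutput ε δ n ω = some a ∧ ¬ (advInstance n ε h0 h1).IsEpsBest ε a} := by
  refine (lt_no_best_stored h0 h1 hδ hL hn).trans_le (measureReal_mono ?_)
  intro ω hω
  obtain ⟨l, a, h, h'⟩ := exists_assadiOutput (ε := ε) (δ := δ) ω (by omega : 0 < n)
  exact ⟨a, h', hω l a h⟩

theorem measurableSet_assadiOutput (ε δ : ℝ) (n : ℕ) (P : Option (Fin n) → Prop) :
    MeasurableSet {ω | P (assadiOutput ε δ n ω)} := by
  have h := (discreteMeasurable_memoryAfter ε δ n n le_rfl).mono (pullAlgebra_le _)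
  simp only [memoryAfter_self] at h
  exact (h.comp fun M => M.topArm (numLevels n)).measurableSet P

/-- On the shortest admissible stream, `n = 16 * 32768 + 1`, success with probability at least `1 -
δ` and the disjoint failure event of probability above `δ` would add up to more than 1. -/
theorem not_isPAC {ε δ : ℝ} (h0 : 0 < ε) (h1 : ε < 1 / 5) (hδ : 0 < δ)
    (hL : 100000 ≤ Real.log (1 / δ)) : ¬ IsPAC ε δ (assadiOutput ε δ) := by
  intro h
  let I := advInstance 524289 ε h0 h1
  have hgood := h 524289 (by norm_num) I
  have hbad := lt_output_not_best h0 h1 hδ hL (n := 524289) (by norm_num)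
  have hunion := measureReal_union (μ := I.tableLaw)
    (s₁ := {ω | ∃ a, assadiOutput ε δ 524289 ω = some a ∧ I.IsEpsBest ε a})
    (s₂ := {ω | ∃ a, assadiOutput ε δ 524289 ω = some a ∧ ¬ I.IsEpsBest ε a})
    (by
      refine Set.disjoint_left.2 ?_
      rintro ω ⟨a, ha, hb⟩ ⟨a', ha', hb'⟩
      rw [ha, Option.some.injEq] at ha'
      exact hb' (ha' ▸ hb))
    (measurableSet_assadiOutput ε δ 524289 fun o => ∃ a, o = some a ∧ ¬ I.IsEpsBest ε a)
  have hle := measureReal_le_one (μ := I.tableLaw)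
    (s := {ω | ∃ a, assadiOutput ε δ 524289 ω = some a ∧ I.IsEpsBest ε a} ∪
      {ω | ∃ a, assadiOutput ε δ 524289 ω = some a ∧ ¬ I.IsEpsBest ε a})
  linarith

end StreamingBandit

theorem mainTheorem5 :
    ∃ δ₀ : ℝ, 0 < δ₀ ∧ δ₀ < 1 / 2 ∧
      ∀ δ : ℝ, 0 < δ → δ ≤ δ₀ →
      ∀ (ε : ℝ) (hε0 : 0 < ε) (hε1 : ε < 1 / 5),
        ε < δ * Real.sqrt (Real.log (1 / δ)) / (cLevel 2 : ℝ) →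
        (∀ n : ℕ, cLevel 1 * cLevel 2 < n →
          (δ < (advInstance n ε hε0 hε1).tableLaw.real
              {ω | ∃ a, assadiOutput ε δ n ω = some a ∧
                ¬ (advInstance n ε hε0 hε1).IsEpsBest ε a}) ∧
          (δ < (advInstance n ε hε0 hε1).tableLaw.real
              {ω | ∀ l a, (finalMemory ε δ n ω).stored l = some a →
                ¬ (advInstance n ε hε0 hε1).IsEpsBest ε a})) ∧
        ¬ IsPAC ε δ (assadiOutput ε δ) := by
  refine ⟨Real.exp (-100000), Real.exp_pos _, ?_, ?_⟩
  · rw [Real.exp_neg, one_div]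
    exact inv_strictAnti₀ (by norm_num) (by linarith [Real.add_one_le_exp (100000 : ℝ)])
  · intro δ hδ hδ' ε hε0 hε1 _
    have hL : 100000 ≤ Real.log (1 / δ) := by
      rw [one_div, Real.log_inv, le_neg, ← Real.log_exp (-100000)]
      exact Real.log_le_log hδ hδ'
    refine ⟨fun n hn => ?_, not_isPAC hε0 hε1 hδ hL⟩
    rw [cLevel_one, cLevel_two] at hn
    exact ⟨lt_output_not_best hε0 hε1 hδ hL hn, lt_no_best_stored hε0 hε1 hδ hL hn⟩
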